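/- Let $d\ge 0$ and $N\ge 1$ be integers and let $F(t)=\sum_{k=0}^m\alpha_k t^k$ be a polynomial with rational coefficients $\alpha_k$. Let $S^d\subset\mathbb R^{d+1}$ be the unit sphere and put $$S=\{Q\in\mathbb R^{N\times N} : Q\succeq 0,\ Q_{ii}=1 \text{ for all } i,\ \operatorname{rank} Q\le d+1\},$$ where $Q\succeq 0$ means that $Q$ is symmetric and positive semidefinite. For points $x_1,\dots,x_N\in S^d$ (not necessarily distinct) let $\nu_x=\frac1N\sum_{i=1}^N\delta_{x_i}$, and for a measure $\nu$ on $S^d$ let $I_F(\nu)=\int\!\!\int F(\langle x,y\rangle)\,d\nu(x)\,d\nu(y)$. Then: 1. $S$ is exactly the set of Gram matrices $(\langle x_i,x_j\rangle)_{i,j=1}^N$ of configurations $x_1,\dots,x_N\in S^d$, and for such a configuration with Gram matrix $Q$ one has $I_F(\nu_x)=\frac1{N^2}\sum_{i,j=1}^N F(Q_{ij})$. 2. The minimal energy of $N$ equally weighted points on $S^d$, $$Q^*=\min_{x_1,\dots,x_N\in S^d} I_F(\nu_x)=\min_{Q\in S}\frac1{N^2}\sum_{i,j=1}^N F(Q_{ij}),$$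 exists (both minima are attained), and $Q^*$ is an algebraic number, i.e. algebraic over $\mathbb Q$. -/

import Mathlib

open MeasureTheory
open scoped ENNReal

noncomputable section

/-- The unit sphere `S^d` in the Euclidean space `ℝ^(d+1)`. -/
abbrev UnitSphere (d : ℕ) : Type :=
  Metric.sphere (0 : EuclideanSpace ℝ (Fin (d + 1))) 1

/-- The probability measure `(1/N) ∑ i, δ_{x i}` of `N` equally weighted points of `S^d`
(the points need not be distinct). -/
def equalWeightMeasure {d N : ℕ} (x : Fin N → UnitSphere d) : Measure (UnitSphere d) :=
  (N : ℝ≥0∞)⁻¹ • ∑ i, Measure.dirac (x i)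

/-- The energy integral `I_F(ν) = ∫ ∫ F(⟨x, y⟩) dν(x) dν(y)` of a measure on `S^d`, for a
polynomial potential `F` with rational coefficients. -/
def energyIntegral {d : ℕ} (F : Polynomial ℚ) (ν : Measure (UnitSphere d)) : ℝ :=
  ∫ y, ∫ x, Polynomial.aeval
    (inner ℝ (x : EuclideanSpace ℝ (Fin (d + 1))) (y : EuclideanSpace ℝ (Fin (d + 1)))) F ∂ν ∂ν

/-- The Gram matrix `(⟨x i, x j⟩)` of a configuration of `N` points of `S^d`. -/
def configGram {d N : ℕ} (x : Fin N → UnitSphere d) : Matrix (Fin N) (Fin N) ℝ :=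
  Matrix.gram ℝ (fun i => (x i : EuclideanSpace ℝ (Fin (d + 1))))

/-- Positive semidefinite real `N × N` matrices with unit diagonal and rank at most `d + 1`. -/
def feasibleMatrices (d N : ℕ) : Set (Matrix (Fin N) (Fin N) ℝ) :=
  {Q | Q.PosSemidef ∧ (∀ i, Q i i = 1) ∧ Q.rank ≤ d + 1}

/-- The energy `(1/N²) ∑ i j, F(Q i j)` of a matrix. -/
def matrixEnergy {N : ℕ} (F : Polynomial ℚ) (Q : Matrix (Fin N) (Fin N) ℝ) : ℝ :=
  1 / (N : ℝ) ^ 2 * ∑ i, ∑ j, Polynomial.aeval (Q i j) F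

end

/-! A minimiser `x` exists by compactness. If its energy `c` were transcendental, some ℚ-derivation
`D` of ℝ would satisfy `D c = 1`. Put `v i = D (x i)` coordinatewise. Applying `D` to `⟨x i, x i⟩ =
1` shows that `v` is tangent to the product of spheres. Since `F` has rational coefficients, `D c`
equals the directional derivative of the energy at `x` along `v`, which vanishes at a minimum: a
contradiction. No elimination theory is needed. -/

/-- Extend `c` to a transcendence basis `s`. In characteristic zero `L` is formally étale over
`k[s]` (a localization, then a separable algebraic extension), so the derivation of `k[s]` sending
every variable to 1 extends to `L`. -/
theorem exists_derivation_eq_one_of_transcendental {k L : Type*} [Field k] [CharZero k] [Field L]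
    [Algebra k L] {c : L} (hc : Transcendental k c) : ∃ D : Derivation k L L, D c = 1 := by
  have hsing : AlgebraicIndepOn k id ({c} : Set L) := by
    have : AlgebraicIndependent k (fun i : ({c} : Set L) => (i : L)) :=
      (algebraicIndependent_unique_type_iff (R := k)).mpr hc
    exact this
  obtain ⟨s, hcs, hs⟩ := exists_isTranscendenceBasis_superset hsing
  let P := MvPolynomial s k
  let : Algebra P L := (MvPolynomial.aeval (R := k) ((↑) : s → L)).toRingHom.toAlgebra
  have hmap (p : P) : algebraMap P L p = MvPolynomial.aeval ((↑) : s → L) p := rfl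
  have : IsScalarTower k P L := .of_algebraMap_eq fun r => by
    rw [hmap, MvPolynomial.algebraMap_eq, MvPolynomial.aeval_C]
  have hinj : Function.Injective (algebraMap P L) := hs.1
  have : FaithfulSMul P L := (faithfulSMul_iff_algebraMap_injective P L).mpr hinj
  have : Algebra.IsAlgebraic P L := by
    have := hs.isAlgebraic
    refine ⟨fun a => ?_⟩
    have ha := Algebra.IsAlgebraic.isAlgebraic (R := Algebra.adjoin k (Set.range ((↑) : s → L))) a
    refine IsAlgebraic.of_ringHom_of_comp_eq (g := RingHom.id L) (f := (hs.1.aevalEquiv : P →+* _)) ha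
      hs.1.aevalEquiv.surjective Function.injective_id ?_
    ext <;> simp [hmap]
  let := FractionRing.liftAlgebra P L
  have := FractionRing.isScalarTower_liftAlgebra P L
  have : Algebra.IsAlgebraic (FractionRing P) L :=
    (IsFractionRing.comap_isAlgebraic_iff (A := P)).mp inferInstance
  have : Algebra.FormallyEtale (FractionRing P) L := .of_isSeparable _ _
  have : Algebra.FormallyEtale P (FractionRing P) := .of_isLocalization (nonZeroDivisors P)
  have : Algebra.FormallyEtale P L := .comp P (FractionRing P) L
  let φ : Ω[L⁄k] →ₗ[L] L :=
    ((MvPolynomial.mkDerivation k (fun _ : s => (1 : L))).liftKaehlerDifferential.liftBaseChange L).comp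
      (KaehlerDifferential.tensorKaehlerEquivOfFormallyEtale k P L).symm.toLinearMap
  refine ⟨φ.compDer (KaehlerDifferential.D k L), ?_⟩
  have hX : c = algebraMap P L (MvPolynomial.X ⟨c, hcs rfl⟩) := by simp [hmap]
  have h := KaehlerDifferential.tensorKaehlerEquivOfFormallyEtale_symm_D_algebraMap k P L
    (MvPolynomial.X ⟨c, hcs rfl⟩)
  rw [← hX] at h
  have hφ : φ (KaehlerDifferential.D k L c) = 1 := by
    rw [LinearMap.comp_apply, LinearEquiv.coe_coe, h, LinearMap.liftBaseChange_tmul, one_smul,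
      Derivation.liftKaehlerDifferential_comp_D, MvPolynomial.mkDerivation_X]
  exact hφ

-- Write `Q = Bᴴ B`. The columns of `B` span a space of dimension `rank Q ≤ d`; coordinates in an
-- orthonormal basis of it, padded with zeros, give vectors of `ℝ^d` with the same inner products.
open scoped MatrixOrder Matrix.Norms.L2Operator in
theorem exists_gram_eq_of_posSemidef {n d : ℕ} {Q : Matrix (Fin n) (Fin n) ℝ}
    (hQ : Q.PosSemidef) (hr : Q.rank ≤ d) :
    ∃ v : Fin n → EuclideanSpace ℝ (Fin d), Matrix.gram ℝ v = Q := by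
  obtain ⟨B, rfl⟩ := CStarAlgebra.nonneg_iff_eq_star_mul_self.mp hQ.nonneg
  rw [Matrix.star_eq_conjTranspose, Matrix.rank_conjTranspose_mul_self,
    Matrix.rank_eq_finrank_span_cols] at hr
  let w (i : Fin n) : EuclideanSpace ℝ (Fin n) := WithLp.toLp 2 (B.col i)
  let W := Submodule.span ℝ (Set.range w)
  have hW : Module.finrank ℝ W ≤ d := by
    refine le_trans (le_of_eq ?_) hr
    have : Submodule.span ℝ (Set.range B.col) =
        W.map (WithLp.linearEquiv 2 ℝ (Fin n → ℝ)).toLinearMap := by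
      rw [Submodule.map_span, ← Set.range_comp]
      rfl
    rw [this]
    exact (LinearEquiv.finrank_map_eq _ _).symm
  let b := stdOrthonormalBasis ℝ W
  let u (i : Fin n) : W := ⟨w i, Submodule.subset_span ⟨i, rfl⟩⟩
  let e (k : Fin (Module.finrank ℝ W)) : EuclideanSpace ℝ (Fin d) :=
    EuclideanSpace.basisFun (Fin d) ℝ (Fin.castLE hW k)
  have he : Orthonormal ℝ e :=
    (EuclideanSpace.basisFun (Fin d) ℝ).orthonormal.comp _ (Fin.castLE_injective hW)
  refine ⟨fun i => ∑ k, b.repr (u i) k • e k, ?_⟩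
  ext i j
  rw [Matrix.gram_apply, he.inner_sum]
  have h1 : inner ℝ (u i) (u j) = ∑ k, b.repr (u i) k * b.repr (u j) k := by
    rw [← b.repr.inner_map_map, PiLp.inner_apply]
    exact Finset.sum_congr rfl fun k _ => mul_comm _ _
  have h2 : inner ℝ (u i) (u j) = (star B * B) i j := by
    rw [Submodule.coe_inner, PiLp.inner_apply, Matrix.mul_apply]
    exact Finset.sum_congr rfl fun k _ => mul_comm _ _
  rw [← h2, h1]
  rfl

theorem range_configGram (d N : ℕ) :
    Set.range (fun x : Fin N → UnitSphere d => configGram x) = feasibleMatrices d N := by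
  ext Q
  constructor
  · rintro ⟨x, rfl⟩
    refine ⟨Matrix.posSemidef_gram ℝ _, fun i => ?_, ?_⟩
    · simp [configGram, Matrix.gram_apply]
    · dsimp only [configGram]
      rw [Matrix.gram_eq_conjTranspose_mul (EuclideanSpace.basisFun (Fin (d + 1)) ℝ)]
      refine (Matrix.rank_mul_le_right _ _).trans ?_
      simpa using Matrix.rank_le_card_height
        (Matrix.of fun (i : Fin (d + 1)) (j : Fin N) =>
          (EuclideanSpace.basisFun (Fin (d + 1)) ℝ).repr (x j : EuclideanSpace ℝ (Fin (d + 1))) i)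
  · rintro ⟨hQ, hdiag, hr⟩
    obtain ⟨v, rfl⟩ := exists_gram_eq_of_posSemidef hQ hr
    refine ⟨fun i => ⟨v i, ?_⟩, rfl⟩
    have h := hdiag i
    rw [Matrix.gram_apply, real_inner_self_eq_norm_sq] at h
    rw [mem_sphere_zero_iff_norm]
    exact (pow_eq_one_iff_of_nonneg (norm_nonneg _) two_ne_zero).mp h

theorem integral_equalWeightMeasure {d N : ℕ} (x : Fin N → UnitSphere d) (f : UnitSphere d → ℝ) :
    ∫ y, f y ∂equalWeightMeasure x = (N : ℝ)⁻¹ * ∑ i, f (x i) := by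
  rw [equalWeightMeasure, integral_smul_measure, integral_finsetSum_measure]
  · simp
  · intro i _
    exact integrable_dirac (by simp)

theorem energyIntegral_equalWeightMeasure {d N : ℕ} (F : Polynomial ℚ)
    (x : Fin N → UnitSphere d) :
    energyIntegral F (equalWeightMeasure x) = matrixEnergy F (configGram x) := by
  simp only [energyIntegral, integral_equalWeightMeasure, matrixEnergy, configGram,
    Matrix.gram_apply]
  rw [← Finset.mul_sum, Finset.sum_comm, ← mul_assoc]
  congr 1
  ring

theorem continuous_matrixEnergy_configGram {d N : ℕ} (F : Polynomial ℚ) :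
    Continuous fun x : Fin N → UnitSphere d => matrixEnergy F (configGram x) := by
  simp only [matrixEnergy, configGram, Matrix.gram_apply]
  refine continuous_const.mul (continuous_finsetSum _ fun i _ => continuous_finsetSum _ fun j _ => ?_)
  exact F.continuous_aeval.comp (by fun_prop)

theorem exists_matrixEnergy_configGram_le (d N : ℕ) (F : Polynomial ℚ) :
    ∃ x : Fin N → UnitSphere d, ∀ y : Fin N → UnitSphere d,
      matrixEnergy F (configGram x) ≤ matrixEnergy F (configGram y) := by
  have : Nonempty (UnitSphere d) := (NormedSpace.sphere_nonempty.mpr zero_le_one).to_subtype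
  obtain ⟨x, -, hx⟩ := isCompact_univ.exists_isMinOn Set.univ_nonempty
    (continuous_matrixEnergy_configGram (d := d) (N := N) F).continuousOn
  exact ⟨x, fun y => hx (Set.mem_univ y)⟩

/-- The curve `t ↦ (p + t v) / √(1 + t² ‖v‖²)`, which stays on the unit sphere if `p` is a unit
vector orthogonal to `v`. -/
noncomputable def sphereCurve {E : Type*} [NormedAddCommGroup E] [InnerProductSpace ℝ E] (p v : E) (t : ℝ) : E :=
  (√(1 + t ^ 2 * ‖v‖ ^ 2))⁻¹ • (p + t • v)

theorem norm_sphereCurve {E : Type*} [NormedAddCommGroup E] [InnerProductSpace ℝ E] {p v : E}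
    (hp : ‖p‖ = 1) (hv : inner ℝ p v = 0) (t : ℝ) : ‖sphereCurve p v t‖ = 1 := by
  have hpos : 0 < 1 + t ^ 2 * ‖v‖ ^ 2 := by positivity
  have h : ‖p + t • v‖ = √(1 + t ^ 2 * ‖v‖ ^ 2) := by
    rw [eq_comm, Real.sqrt_eq_iff_mul_self_eq hpos.le (norm_nonneg _), ← sq,
      norm_add_sq_real, inner_smul_right, hv, hp, norm_smul, mul_pow, Real.norm_eq_abs, sq_abs]
    ring
  rw [sphereCurve, norm_smul, h, norm_inv, Real.norm_of_nonneg (Real.sqrt_nonneg _)]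
  exact inv_mul_cancel₀ (Real.sqrt_pos.mpr hpos).ne'

theorem sphereCurve_zero {E : Type*} [NormedAddCommGroup E] [InnerProductSpace ℝ E] (p v : E) :
    sphereCurve p v 0 = p := by
  simp [sphereCurve]

/-- The normalising factor depends on `t` only through `t²`, so it does not contribute at first
order. -/
theorem hasDerivAt_sphereCurve {E : Type*} [NormedAddCommGroup E] [InnerProductSpace ℝ E]
    (p v : E) : HasDerivAt (sphereCurve p v) v 0 := by
  have h1 : HasDerivAt (fun t : ℝ => 1 + t ^ 2 * ‖v‖ ^ 2) 0 0 := by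
    simpa using ((hasDerivAt_pow 2 (0 : ℝ)).mul_const (‖v‖ ^ 2)).const_add 1
  have h2 : HasDerivAt (fun t : ℝ => (√(1 + t ^ 2 * ‖v‖ ^ 2))⁻¹) 0 0 := by
    simpa using (h1.sqrt (by simp)).fun_inv (by simp)
  have h3 : HasDerivAt (fun t : ℝ => p + t • v) v 0 := by
    simpa using ((hasDerivAt_id (0 : ℝ)).smul_const v).const_add p
  have h := h2.fun_smul h3
  simp only [ne_eq, OfNat.ofNat_ne_zero, not_false_eq_true, zero_pow, zero_mul, add_zero,
    Real.sqrt_one, inv_one, one_smul, zero_smul] at h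
  exact h

/-- First-order optimality condition on a product of spheres. -/
theorem sum_derivative_eq_zero_of_isMin {d N : ℕ} {F : Polynomial ℚ} {x : Fin N → UnitSphere d}
    (hx : ∀ y : Fin N → UnitSphere d,
      matrixEnergy F (configGram x) ≤ matrixEnergy F (configGram y))
    (v : Fin N → EuclideanSpace ℝ (Fin (d + 1)))
    (hv : ∀ i, inner ℝ (x i : EuclideanSpace ℝ (Fin (d + 1))) (v i) = 0) :
    1 / (N : ℝ) ^ 2 * ∑ i, ∑ j, Polynomial.aeval (configGram x i j) F.derivative *
      (inner ℝ (x i : EuclideanSpace ℝ (Fin (d + 1))) (v j) +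
        inner ℝ (v i) (x j : EuclideanSpace ℝ (Fin (d + 1)))) = 0 := by
  let y (t : ℝ) (i : Fin N) : UnitSphere d :=
    ⟨sphereCurve (x i : EuclideanSpace ℝ (Fin (d + 1))) (v i) t,
      mem_sphere_zero_iff_norm.mpr (norm_sphereCurve (norm_eq_of_mem_sphere (x i)) (hv i) t)⟩
  have hy0 : y 0 = x := funext fun i => Subtype.ext (sphereCurve_zero _ _)
  have hmin : IsLocalMin (fun t => matrixEnergy F (configGram (y t))) 0 :=
    Filter.Eventually.of_forall fun t => by simpa only [hy0] using hx (y t)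
  refine hmin.hasDerivAt_eq_zero ?_
  simp only [matrixEnergy]
  refine HasDerivAt.const_mul _ (HasDerivAt.fun_sum fun i _ => HasDerivAt.fun_sum fun j _ => ?_)
  have h : HasDerivAt (fun t => configGram (y t) i j)
      (inner ℝ (x i : EuclideanSpace ℝ (Fin (d + 1))) (v j) +
        inner ℝ (v i) (x j : EuclideanSpace ℝ (Fin (d + 1)))) 0 := by
    have := (hasDerivAt_sphereCurve (x i : EuclideanSpace ℝ (Fin (d + 1))) (v i)).inner ℝ
      (hasDerivAt_sphereCurve (x j : EuclideanSpace ℝ (Fin (d + 1))) (v j))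
    rw [sphereCurve_zero, sphereCurve_zero] at this
    exact this
  have hF := F.hasDerivAt_aeval (configGram (y 0) i j)
  rw [hy0] at hF
  exact HasDerivAt.comp (h₂ := fun q => Polynomial.aeval q F) 0 (by rw [hy0]; exact hF) h

theorem Derivation.map_inner_euclideanSpace {ι : Type*} [Fintype ι] (D : Derivation ℚ ℝ ℝ)
    (p q : EuclideanSpace ℝ ι) :
    D (inner ℝ p q) = inner ℝ p (WithLp.toLp 2 fun k => D (q k)) +
      inner ℝ (WithLp.toLp 2 fun k => D (p k)) q := by
  simp only [PiLp.inner_apply, map_sum, ← Finset.sum_add_distrib]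
  refine Finset.sum_congr rfl fun k _ => ?_
  simp [mul_comm]

theorem isAlgebraic_matrixEnergy_of_isMin {d N : ℕ} {F : Polynomial ℚ} {x : Fin N → UnitSphere d}
    (hx : ∀ y : Fin N → UnitSphere d,
      matrixEnergy F (configGram x) ≤ matrixEnergy F (configGram y)) :
    IsAlgebraic ℚ (matrixEnergy F (configGram x)) := by
  by_contra hc
  obtain ⟨D, hD⟩ := exists_derivation_eq_one_of_transcendental hc
  let v (i : Fin N) : EuclideanSpace ℝ (Fin (d + 1)) :=
    WithLp.toLp 2 fun k => D ((x i : EuclideanSpace ℝ (Fin (d + 1))) k)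
  have hv (i : Fin N) : inner ℝ (x i : EuclideanSpace ℝ (Fin (d + 1))) (v i) = 0 := by
    have h := D.map_inner_euclideanSpace (x i : EuclideanSpace ℝ (Fin (d + 1))) (x i)
    rw [real_inner_self_eq_norm_sq, norm_eq_of_mem_sphere, one_pow,
      D.map_one_eq_zero] at h
    change 0 = inner ℝ _ (v i) + inner ℝ (v i) _ at h
    rw [real_inner_comm] at h
    linarith [real_inner_comm (v i) (x i : EuclideanSpace ℝ (Fin (d + 1)))]
  have hcrit := sum_derivative_eq_zero_of_isMin hx v hv
  -- The prefactor is rational, hence killed by `D`.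
  have hN : D (1 / (N : ℝ) ^ 2) = 0 := by
    have h := D.map_algebraMap (1 / (N : ℚ) ^ 2)
    rwa [eq_ratCast, Rat.cast_div, Rat.cast_pow, Rat.cast_one, Rat.cast_natCast] at h
  rw [matrixEnergy, D.leibniz, hN, smul_zero, add_zero, smul_eq_mul] at hD
  simp only [map_sum, Derivation.map_aeval, smul_eq_mul] at hD
  -- By the chain and Leibniz rules `D` of the energy agrees term by term with the derivative along
  -- `v` in `hcrit`.
  refine one_ne_zero (hD.symm.trans (Eq.trans ?_ hcrit))
  simp only [configGram, Matrix.gram_apply, Derivation.map_inner_euclideanSpace, v]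

theorem mainTheorem2 (d N : ℕ) (hN : 0 < N) (F : Polynomial ℚ) :
    Set.range (fun x : Fin N → UnitSphere d => configGram x) = feasibleMatrices d N ∧
    (∀ x : Fin N → UnitSphere d,
      energyIntegral F (equalWeightMeasure x) = matrixEnergy F (configGram x)) ∧
    ∃ Qstar : ℝ,
      IsLeast (matrixEnergy F '' feasibleMatrices d N) Qstar ∧
      IsLeast (Set.range fun x : Fin N → UnitSphere d =>
        energyIntegral F (equalWeightMeasure x)) Qstar ∧
      IsAlgebraic ℚ Qstar := by
  refine ⟨range_configGram d N, energyIntegral_equalWeightMeasure F, ?_⟩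
  obtain ⟨x, hx⟩ := exists_matrixEnergy_configGram_le d N F
  refine ⟨_, ?_, ?_, isAlgebraic_matrixEnergy_of_isMin hx⟩
  · rw [← range_configGram, ← Set.range_comp]
    exact ⟨⟨x, rfl⟩, Set.forall_mem_range.mpr hx⟩
  · simp only [energyIntegral_equalWeightMeasure]
    exact ⟨⟨x, rfl⟩, Set.forall_mem_range.mpr hx⟩
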